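/- Let $W_0(\mathbb R)$ be the set of functions $f:\mathbb R\to\mathbb C$ of the form $f(x)=\int_{\mathbb R}e^{ixy}h(y)\,dy$ (for all $x\in\mathbb R$) with $h\in L_1(\mathbb R)$, and let $W_0^*(\mathbb R)$ be the set of those $f\in W_0(\mathbb R)$ whose representing function $h$ satisfies in addition $$\int_0^\infty \operatorname*{ess\,sup}_{|s|\ge t}|h(s)|\,dt<\infty .$$ 1) For every $f\in W_0(\mathbb R)$ there exists an even function $g:\mathbb R\to\mathbb R$, strictly increasing on $[0,\infty)$ with $g(x)\to+\infty$ as $x\to+\infty$ (so that, in particular, $g(|k|)\uparrow+\infty$ as $|k|\to\infty$ over the integers $k$), such that the pointwise product $gf$ belongs to $W_0(\mathbb R)$. In particular, there is a function in $W_0(\mathbb R)$ whose value at every integer $k$ is $g(|k|)f(k)$. 2) For every real sequence $(\varepsilon_k)_{k\ge 0}$ that is monotone decreasing (non-increasing) with $\varepsilon_k\to0$, there exists an even real-valued function $f\in W_0^*(\mathbb R)$ such that $f(k)\ge\varepsilon_k$ for all integers $k\ge0$. -/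

import Mathlib

open MeasureTheory Set Filter Topology

/-- `f` is the Fourier integral of `g`: `f x = ∫ e^{ixy} g y dy` for every real `x`. -/
def IsFourierIntegralOf (f g : ℝ → ℂ) : Prop :=
  ∀ x : ℝ, f x = ∫ y : ℝ, Complex.exp (Complex.I * x * y) * g y

/-- The Wiener algebra `W₀(ℝ)` of Fourier integrals of integrable functions. -/
def WienerW0 : Set (ℝ → ℂ) :=
  {f | ∃ g : ℝ → ℂ, Integrable g ∧ IsFourierIntegralOf f g}

/-- The class `W₀*(ℝ)`: Fourier integrals of integrable functions `g` with
`∫₀^∞ ess sup_{|s| ≥ t} |g s| dt < ∞`. -/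
def WienerW0Star : Set (ℝ → ℂ) :=
  {f | ∃ g : ℝ → ℂ, Integrable g ∧ IsFourierIntegralOf f g ∧
    ∫⁻ t in Ioi (0 : ℝ), essSup (fun s : ℝ => ‖g s‖ₑ) (volume.restrict {s : ℝ | t ≤ |s|}) < ⊤}

/-!
Let `Gᵥ` be the centred Gaussian density of variance `v`, whose Fourier integral is
`exp (-v x² / 2)`.

If `f` is the Fourier integral of `h`, then `(1 - exp (-v x² / 2)) * f x` is that of `h - Gᵥ ⋆ h`,
whose `L¹` norm is at most the average against `Gᵥ` of the `L¹` modulus of continuity of `h`, and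
hence tends to `0` with `v`. If the variances `vⱼ` decrease so fast that both they and these norms
are summable, then `g x = ∑ⱼ (1 - exp (-vⱼ x² / 2))` converges, increases to `+∞`, and `g * f` is a
Fourier integral.

For the second part take `∑ⱼ cⱼ exp (-vⱼ x² / 2)`, the Fourier integral of `∑ⱼ cⱼ Gᵥⱼ`. As a
Gaussian density decreases in `|s|`, its supremum over `|s| ≥ t` is its value at `t`, so the `W₀*`
integral is at most `∑ⱼ cⱼ`. Geometric weights suffice: the superlevel set of `ε` at height
`A 2⁻ʲ⁻¹` lies in some interval `|x| ≤ Rⱼ`, on which the choice `vⱼ = 2 / Rⱼ²` gives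
`exp (-vⱼ x² / 2) ≥ 1 / e`, so that `cⱼ = e A 2⁻ʲ` dominates the values of `ε` between
`A 2⁻ʲ⁻¹` and `A 2⁻ʲ`.
-/

open ProbabilityTheory ContinuousLinearMap
open scoped NNReal Convolution FourierTransform

section translationModulus

variable {G E : Type*} [MeasurableSpace G] [NormedAddCommGroup E] {μ : Measure G} {h : G → E}

/-- The `L¹` modulus of continuity `s ↦ ‖h - h(· - s)‖₁` of `h`. It is meant for integrable `h`;
otherwise the Bochner integral may take its default value `0`. -/
noncomputable def translationModulus [Sub G] (μ : Measure G) (h : G → E) (s : G) : ℝ :=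
  ∫ y, ‖h y - h (y - s)‖ ∂μ

theorem translationModulus_nonneg [Sub G] (s : G) : 0 ≤ translationModulus μ h s := by
  unfold translationModulus
  positivity

theorem translationModulus_zero [AddGroup G] : translationModulus μ h 0 = 0 := by
  simp [translationModulus]

theorem translationModulus_le [AddGroup G] [MeasurableAdd G] [μ.IsAddRightInvariant]
    (hi : Integrable h μ) (s : G) : translationModulus μ h s ≤ 2 * ∫ y, ‖h y‖ ∂μ := by
  calc translationModulus μ h s ≤ ∫ y, (‖h y‖ + ‖h (y - s)‖) ∂μ :=
        integral_mono (hi.sub (hi.comp_sub_right s)).norm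
          (hi.norm.add (hi.comp_sub_right s).norm) fun _ => norm_sub_le _ _
    _ = 2 * ∫ y, ‖h y‖ ∂μ := by
        rw [integral_add hi.norm (hi.comp_sub_right s).norm,
          integral_sub_right_eq_self (fun y => ‖h y‖) s, two_mul]

theorem continuous_translationModulus [AddCommGroup G] [TopologicalSpace G]
    [IsTopologicalAddGroup G] [BorelSpace G] [IsLocallyFiniteMeasure μ]
    [μ.InnerRegularCompactLTTop] [μ.IsAddLeftInvariant] (hi : Integrable h μ) :
    Continuous (translationModulus μ h) := by
  have : Fact ((1 : ENNReal) ≠ ⊤) := ⟨ENNReal.one_ne_top⟩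
  have hL : MemLp h 1 μ := memLp_one_iff_integrable.2 hi
  have hτ (s : G) : MemLp (fun y => h (-s +ᵥ y)) 1 μ :=
    hL.comp_measurePreserving (measurePreserving_vadd (-s) μ)
  have hnorm (s : G) :
      translationModulus μ h s = ‖hL.toLp h - (DomAddAct.mk (-s) +ᵥ hL.toLp h)‖ := by
    rw [DomAddAct.mk_vadd_toLp, ← MemLp.toLp_sub, L1.norm_eq_integral_norm]
    refine integral_congr_ae ?_
    filter_upwards [(hL.sub (hτ s)).coeFn_toLp] with y hy
    rw [hy, Pi.sub_apply, vadd_eq_add, neg_add_eq_sub]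
  have hmk : Continuous fun s : G => DomAddAct.mk (-s) :=
    DomAddAct.continuous_mk.comp continuous_neg
  rw [funext hnorm]
  exact (continuous_const.sub (hmk.vadd continuous_const)).norm

theorem integral_norm_sub_convolution_le {𝕜 : Type*} [RCLike 𝕜] [NormedSpace ℝ E]
    [NormedSpace 𝕜 E] [CompleteSpace E] [AddGroup G] [MeasurableAdd₂ G] [MeasurableNeg G]
    [SFinite μ] [μ.IsAddRightInvariant] {ρ : G → 𝕜} (hρ : Integrable ρ μ) (hρ1 : ∫ u, ρ u ∂μ = 1)
    (hi : Integrable h μ) :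
    ∫ y, ‖h y - (ρ ⋆[lsmul 𝕜 𝕜, μ] h) y‖ ∂μ ≤ ∫ u, ‖ρ u‖ * translationModulus μ h u ∂μ := by
  have hprod : Integrable (fun p : G × G => ρ p.2 • (h p.1 - h (p.1 - p.2))) (μ.prod μ) := by
    simpa only [smul_sub, lsmul_apply] using!
      (hρ.smul_prod hi).swap.sub (hρ.convolution_integrand (lsmul 𝕜 𝕜) hi)
  have hsub : ∀ᵐ y ∂μ, h y - (ρ ⋆[lsmul 𝕜 𝕜, μ] h) y = ∫ u, ρ u • (h y - h (y - u)) ∂μ := by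
    filter_upwards [hρ.ae_convolution_exists (lsmul 𝕜 𝕜) hi] with y hy
    calc h y - (ρ ⋆[lsmul 𝕜 𝕜, μ] h) y
        = ∫ u, ρ u • h y ∂μ - ∫ u, ρ u • h (y - u) ∂μ := by
          rw [integral_smul_const, hρ1, one_smul, convolution_lsmul]
      _ = ∫ u, ρ u • (h y - h (y - u)) ∂μ := by
          simp only [smul_sub]
          exact (integral_sub (hρ.smul_const (h y)) hy).symm
  calc ∫ y, ‖h y - (ρ ⋆[lsmul 𝕜 𝕜, μ] h) y‖ ∂μ
      = ∫ y, ‖∫ u, ρ u • (h y - h (y - u)) ∂μ‖ ∂μ :=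
        integral_congr_ae (hsub.mono fun y hy => congrArg norm hy)
    _ ≤ ∫ y, ∫ u, ‖ρ u • (h y - h (y - u))‖ ∂μ ∂μ :=
        integral_mono hprod.integral_prod_left.norm hprod.norm.integral_prod_left
          fun y => norm_integral_le_integral_norm _
    _ = ∫ u, ∫ y, ‖ρ u • (h y - h (y - u))‖ ∂μ ∂μ :=
        integral_integral_swap (f := fun y u => ‖ρ u • (h y - h (y - u))‖) hprod.norm
    _ = ∫ u, ‖ρ u‖ * translationModulus μ h u ∂μ := by
        simp only [norm_smul, integral_const_mul, translationModulus]

end translationModulus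

theorem gaussianReal_eq_map_standard (m : ℝ) (v : ℝ≥0) :
    gaussianReal m v = (gaussianReal 0 1).map fun u => √v * u + m := by
  have hcomp : (fun u : ℝ => √v * u + m) = (· + m) ∘ (√v * ·) := rfl
  rw [hcomp, ← Measure.map_map (by fun_prop) (by fun_prop), gaussianReal_map_const_mul,
    gaussianReal_map_add_const]
  congr 1
  · simp
  · ext
    simp

theorem tendsto_integral_gaussianReal_zero {E : Type*} [NormedAddCommGroup E] [NormedSpace ℝ E]
    [CompleteSpace E] {ω : ℝ → E} (hω : Continuous ω) {C : ℝ} (hC : ∀ u, ‖ω u‖ ≤ C) (m : ℝ) :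
    Tendsto (fun v : ℝ≥0 => ∫ u, ω u ∂gaussianReal m v) (𝓝 0) (𝓝 (ω m)) := by
  have hmap (v : ℝ≥0) :
      ∫ u, ω u ∂gaussianReal m v = ∫ u, ω (√v * u + m) ∂gaussianReal 0 1 := by
    rw [gaussianReal_eq_map_standard, integral_map (by fun_prop) hω.aestronglyMeasurable]
  have hlim : ∫ _, ω m ∂gaussianReal 0 1 = ω m := by
    rw [integral_const, probReal_univ, one_smul]
  simp only [hmap]
  rw [← hlim]
  refine tendsto_integral_filter_of_norm_le_const (.of_forall fun v => by fun_prop)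
    ⟨C, .of_forall fun v => ae_of_all _ fun u => hC _⟩ (ae_of_all _ fun u => ?_)
  exact Continuous.tendsto' (by fun_prop) 0 _ (by simp)

theorem integrable_ofReal_gaussianPDFReal (m : ℝ) (v : ℝ≥0) :
    Integrable fun y => (gaussianPDFReal m v y : ℂ) :=
  (integrable_gaussianPDFReal m v).ofReal

theorem tendsto_integral_norm_sub_gaussian_convolution {E : Type*} [NormedAddCommGroup E]
    [NormedSpace ℝ E] [NormedSpace ℂ E] [CompleteSpace E] {h : ℝ → E} (hi : Integrable h) :
    Tendsto
      (fun v : ℝ≥0 => ∫ y, ‖h y - ((fun u => (gaussianPDFReal 0 v u : ℂ)) ⋆[lsmul ℂ ℂ] h) y‖)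
      (𝓝[≠] 0) (𝓝 0) := by
  have hmod : Tendsto (fun v : ℝ≥0 => ∫ u, translationModulus volume h u ∂gaussianReal 0 v)
      (𝓝[≠] 0) (𝓝 0) := by
    have := tendsto_integral_gaussianReal_zero (continuous_translationModulus hi)
      (C := 2 * ∫ y, ‖h y‖) (fun u => ?_) 0
    · rw [translationModulus_zero] at this
      exact this.mono_left nhdsWithin_le_nhds
    · rw [Real.norm_of_nonneg (translationModulus_nonneg u)]
      exact translationModulus_le hi u
  refine squeeze_zero' (.of_forall fun v => by positivity) ?_ hmod
  filter_upwards [self_mem_nhdsWithin] with v hv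
  rw [integral_gaussianReal_eq_integral_smul hv]
  have hmass : ∫ u, (gaussianPDFReal 0 v u : ℂ) = 1 := by
    rw [integral_complex_ofReal, integral_gaussianPDFReal_eq_one 0 hv, Complex.ofReal_one]
  simpa only [Complex.norm_real, Real.norm_of_nonneg (gaussianPDFReal_nonneg 0 v _),
    smul_eq_mul] using
    integral_norm_sub_convolution_le (integrable_ofReal_gaussianPDFReal 0 v) hmass hi

theorem integrable_tsum_of_summable_integral_norm {α E ι : Type*} [MeasurableSpace α]
    {μ : Measure α} [NormedAddCommGroup E] [CompleteSpace E] [Countable ι]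
    {h : ι → α → E} (hi : ∀ i, Integrable (h i) μ)
    (hs : Summable fun i => ∫ a, ‖h i a‖ ∂μ) :
    Integrable (fun a => ∑' i, h i a) μ := by
  have hnorm : ∑' i, ‖(hi i).toL1 (h i)‖ₑ ≠ ⊤ := by
    simpa only [Integrable.enorm_toL1, ← ofReal_integral_norm_eq_lintegral_enorm (hi _)] using
      hs.tsum_ofReal_ne_top
  refine (L1.integrable_coeFn (∑' i, (hi i).toL1 (h i))).congr ?_
  filter_upwards [Lp.hasSum_coeFn_tsum hnorm, ae_all_iff.2 fun i => (hi i).coeFn_toL1]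
    with a hsum hcoe
  simpa only [hcoe] using hsum.tsum_eq.symm

theorem norm_exp_I_mul_ofReal_mul (x y : ℝ) (z : ℂ) :
    ‖Complex.exp (Complex.I * x * y) * z‖ = ‖z‖ := by
  rw [mul_assoc, ← Complex.ofReal_mul, norm_mul, Complex.norm_exp_I_mul_ofReal, one_mul]

theorem integrable_exp_I_mul {h : ℝ → ℂ} (hi : Integrable h) (x : ℝ) :
    Integrable fun y : ℝ => Complex.exp (Complex.I * x * y) * h y :=
  hi.mono ((by fun_prop : Continuous fun y : ℝ =>
    Complex.exp (Complex.I * x * y)).aestronglyMeasurable.mul hi.1)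
    (ae_of_all _ fun y => (norm_exp_I_mul_ofReal_mul x y (h y)).le)

namespace IsFourierIntegralOf

theorem iff_eq_fourier {f h : ℝ → ℂ} :
    IsFourierIntegralOf f h ↔ ∀ x, f x = 𝓕 h (-x / (2 * Real.pi)) := by
  refine forall_congr' fun x => ?_
  rw [Real.fourier_real_eq_integral_exp_smul]
  have hphase (y : ℝ) : ((-2 * Real.pi * y * (-x / (2 * Real.pi)) : ℝ) : ℂ) * Complex.I =
      Complex.I * x * y := by
    rw [show -2 * Real.pi * y * (-x / (2 * Real.pi)) = x * y by field_simp]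
    push_cast
    ring
  simp only [hphase, smul_eq_mul]

variable {f₁ f₂ h₁ h₂ : ℝ → ℂ}

theorem sub (hf₁ : IsFourierIntegralOf f₁ h₁) (hf₂ : IsFourierIntegralOf f₂ h₂)
    (hi₁ : Integrable h₁) (hi₂ : Integrable h₂) :
    IsFourierIntegralOf (fun x => f₁ x - f₂ x) (fun y => h₁ y - h₂ y) := by
  intro x
  simp only [hf₁ x, hf₂ x, mul_sub]
  exact (integral_sub (integrable_exp_I_mul hi₁ x) (integrable_exp_I_mul hi₂ x)).symm

theorem mul (hf₁ : IsFourierIntegralOf f₁ h₁) (hf₂ : IsFourierIntegralOf f₂ h₂)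
    (hi₁ : Integrable h₁) (hi₂ : Integrable h₂) :
    IsFourierIntegralOf (fun x => f₁ x * f₂ x) (h₁ ⋆[lsmul ℂ ℂ] h₂) := by
  rw [iff_eq_fourier] at *
  intro x
  rw [hf₁, hf₂, Real.fourier_smul_convolution_eq hi₁ hi₂, smul_eq_mul]

theorem const_mul (hf : IsFourierIntegralOf f₁ h₁) (c : ℂ) :
    IsFourierIntegralOf (fun x => c * f₁ x) (fun y => c * h₁ y) := by
  intro x
  simp only [hf x, mul_left_comm _ c, integral_const_mul]

theorem tsum {ι : Type*} [Countable ι] {f h : ι → ℝ → ℂ}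
    (hf : ∀ i, IsFourierIntegralOf (f i) (h i)) (hi : ∀ i, Integrable (h i))
    (hs : Summable fun i => ∫ y, ‖h i y‖) :
    IsFourierIntegralOf (fun x => ∑' i, f i x) (fun y => ∑' i, h i y) := by
  intro x
  simp only [hf _ x, ← tsum_mul_left]
  exact integral_tsum_of_summable_integral_norm (fun i => integrable_exp_I_mul (hi i) x)
    (by simpa only [norm_exp_I_mul_ofReal_mul] using hs)

end IsFourierIntegralOf

theorem tsum_mem_WienerW0 {ι : Type*} [Countable ι] {f h : ι → ℝ → ℂ}
    (hf : ∀ i, IsFourierIntegralOf (f i) (h i)) (hi : ∀ i, Integrable (h i))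
    (hs : Summable fun i => ∫ y, ‖h i y‖) :
    (fun x => ∑' i, f i x) ∈ WienerW0 :=
  ⟨_, integrable_tsum_of_summable_integral_norm hi hs, .tsum hf hi hs⟩

theorem lintegral_essSup_enorm_tsum_le {E ι : Type*} [NormedAddCommGroup E] [Countable ι]
    {h : ι → ℝ → E} (hi : ∀ i, AEStronglyMeasurable (h i))
    (hanti : ∀ i (t s : ℝ), |t| ≤ |s| → ‖h i s‖ ≤ ‖h i t‖) :
    ∫⁻ t in Ioi (0 : ℝ),
        essSup (fun s : ℝ => ‖∑' i, h i s‖ₑ) (volume.restrict {s : ℝ | t ≤ |s|}) ≤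
      ∑' i, ∫⁻ t, ‖h i t‖ₑ := by
  have hess (t : ℝ) (ht : t ∈ Ioi 0) :
      essSup (fun s : ℝ => ‖∑' i, h i s‖ₑ) (volume.restrict {s : ℝ | t ≤ |s|}) ≤
        ∑' i, ‖h i t‖ₑ := by
    refine essSup_le_of_ae_le _ (ae_restrict_of_forall_mem
      (measurableSet_le measurable_const measurable_id.abs) fun s hts => ?_)
    refine enorm_tsum_le_tsum_enorm.trans (ENNReal.tsum_le_tsum fun i => ?_)
    exact enorm_le_iff_norm_le.2 (hanti i t s (by rwa [abs_of_pos ht]))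
  calc _ ≤ ∫⁻ t in Ioi (0 : ℝ), ∑' i, ‖h i t‖ₑ := setLIntegral_mono' measurableSet_Ioi hess
    _ ≤ ∫⁻ t, ∑' i, ‖h i t‖ₑ := setLIntegral_le_lintegral _ _
    _ = ∑' i, ∫⁻ t, ‖h i t‖ₑ := lintegral_tsum fun i => (hi i).enorm

theorem tsum_mem_WienerW0Star {ι : Type*} [Countable ι] {f h : ι → ℝ → ℂ}
    (hf : ∀ i, IsFourierIntegralOf (f i) (h i)) (hi : ∀ i, Integrable (h i))
    (hs : Summable fun i => ∫ y, ‖h i y‖)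
    (hanti : ∀ i (t s : ℝ), |t| ≤ |s| → ‖h i s‖ ≤ ‖h i t‖) :
    (fun x => ∑' i, f i x) ∈ WienerW0Star := by
  refine ⟨_, integrable_tsum_of_summable_integral_norm hi hs, .tsum hf hi hs,
    (lintegral_essSup_enorm_tsum_le (fun i => (hi i).1) hanti).trans_lt ?_⟩
  simpa only [ofReal_integral_norm_eq_lintegral_enorm (hi _)] using hs.tsum_ofReal_lt_top

/-- The function `x ↦ exp (-v x² / 2)`, which is the characteristic function of the centred
Gaussian law of variance `v` and so the Fourier integral of its density. -/
noncomputable def gaussianMultiplier (v : ℝ≥0) (x : ℝ) : ℝ :=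
  Real.exp (-(v * x ^ 2 / 2))

section gaussianMultiplier

variable {v : ℝ≥0}

theorem isFourierIntegralOf_gaussianPDFReal (hv : v ≠ 0) :
    IsFourierIntegralOf (fun x => (gaussianMultiplier v x : ℂ))
      (fun y => (gaussianPDFReal 0 v y : ℂ)) := by
  intro x
  calc (gaussianMultiplier v x : ℂ) = charFun (gaussianReal 0 v) x := by
        rw [charFun_gaussianReal, gaussianMultiplier]
        push_cast
        ring_nf
    _ = ∫ y : ℝ, gaussianPDFReal 0 v y • Complex.exp (x * y * Complex.I) := by
        rw [charFun_apply_real, integral_gaussianReal_eq_integral_smul hv]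
    _ = ∫ y : ℝ, Complex.exp (Complex.I * x * y) * (gaussianPDFReal 0 v y : ℂ) := by
        simp only [Complex.real_smul, mul_comm (gaussianPDFReal 0 v _ : ℂ), mul_rotate Complex.I]

theorem gaussianPDFReal_zero_le_of_abs_le (v : ℝ≥0) {t s : ℝ} (hts : |t| ≤ |s|) :
    gaussianPDFReal 0 v s ≤ gaussianPDFReal 0 v t := by
  have := sq_le_sq.2 hts
  simp only [gaussianPDFReal, sub_zero]
  gcongr

theorem gaussianMultiplier_neg (v : ℝ≥0) (x : ℝ) :
    gaussianMultiplier v (-x) = gaussianMultiplier v x := by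
  simp only [gaussianMultiplier, neg_sq]

theorem gaussianMultiplier_nonneg (v : ℝ≥0) (x : ℝ) : 0 ≤ gaussianMultiplier v x :=
  (Real.exp_pos _).le

theorem gaussianMultiplier_le_one (v : ℝ≥0) (x : ℝ) : gaussianMultiplier v x ≤ 1 :=
  Real.exp_le_one_iff.2 (neg_nonpos.2 (by positivity))

theorem one_sub_gaussianMultiplier_le (v : ℝ≥0) (x : ℝ) :
    1 - gaussianMultiplier v x ≤ v * (x ^ 2 / 2) := by
  rw [gaussianMultiplier, mul_div_assoc]
  linarith [Real.one_sub_le_exp_neg (v * (x ^ 2 / 2))]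

theorem strictAntiOn_gaussianMultiplier (hv : v ≠ 0) :
    StrictAntiOn (gaussianMultiplier v) (Ici 0) := by
  intro x hx y _ hxy
  have : (0 : ℝ) < v := NNReal.coe_pos.2 (pos_iff_ne_zero.2 hv)
  have hsq : x ^ 2 < y ^ 2 := pow_lt_pow_left₀ hxy hx two_ne_zero
  unfold gaussianMultiplier
  gcongr

theorem tendsto_gaussianMultiplier_atTop (hv : v ≠ 0) :
    Tendsto (gaussianMultiplier v) atTop (𝓝 0) := by
  have hv' : (0 : ℝ) < v := NNReal.coe_pos.2 (pos_iff_ne_zero.2 hv)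
  exact Real.tendsto_exp_neg_atTop_nhds_zero.comp
    (((tendsto_pow_atTop two_ne_zero).const_mul_atTop hv').atTop_div_const two_pos)

theorem exp_neg_one_le_gaussianMultiplier {R : ℝ≥0} (hR : R ≠ 0) {x : ℝ} (hx : |x| ≤ R) :
    Real.exp (-1) ≤ gaussianMultiplier (2 / R ^ 2) x := by
  have hR' : (0 : ℝ) < R ^ 2 := by positivity
  have hsq : x ^ 2 ≤ R ^ 2 := sq_le_sq.2 (by rwa [NNReal.abs_eq])
  refine Real.exp_le_exp.2 (neg_le_neg ?_)
  calc ((2 / R ^ 2 : ℝ≥0) : ℝ) * x ^ 2 / 2 = x ^ 2 / R ^ 2 := by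
        push_cast
        ring
    _ ≤ 1 := (div_le_one hR').2 hsq

end gaussianMultiplier

/-- The series `∑ᵢ (1 - exp (-vᵢ x² / 2))`. For `x ≠ 0` it diverges, so that `tsum` gives `0`,
unless `∑ᵢ vᵢ < ∞`. -/
noncomputable def gaussianDefect {ι : Type*} (v : ι → ℝ≥0) (x : ℝ) : ℝ :=
  ∑' i, (1 - gaussianMultiplier (v i) x)

section gaussianDefect

variable {ι : Type*} {v : ι → ℝ≥0}

theorem summable_one_sub_gaussianMultiplier (hs : Summable v) (x : ℝ) :
    Summable fun i => 1 - gaussianMultiplier (v i) x :=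
  ((NNReal.summable_coe.2 hs).mul_right (x ^ 2 / 2)).of_nonneg_of_le
    (fun _ => sub_nonneg.2 (gaussianMultiplier_le_one _ x))
    fun _ => one_sub_gaussianMultiplier_le _ x

theorem even_gaussianDefect (v : ι → ℝ≥0) : Function.Even (gaussianDefect v) := fun x => by
  simp only [gaussianDefect, gaussianMultiplier_neg]

theorem strictMonoOn_gaussianDefect [Nonempty ι] (hv : ∀ i, v i ≠ 0) (hs : Summable v) :
    StrictMonoOn (gaussianDefect v) (Ici 0) := by
  intro x hx y hy hxy
  have hterm (i : ι) : 1 - gaussianMultiplier (v i) x < 1 - gaussianMultiplier (v i) y :=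
    sub_lt_sub_left (strictAntiOn_gaussianMultiplier (hv i) hx hy hxy) 1
  exact (summable_one_sub_gaussianMultiplier hs x).tsum_lt_tsum (fun i => (hterm i).le)
    (hterm (Classical.arbitrary ι)) (summable_one_sub_gaussianMultiplier hs y)

theorem tendsto_gaussianDefect_atTop [Infinite ι] (hv : ∀ i, v i ≠ 0) (hs : Summable v) :
    Tendsto (gaussianDefect v) atTop atTop := by
  refine tendsto_atTop.2 fun M => ?_
  obtain ⟨n, hn⟩ := exists_nat_gt M
  obtain ⟨s, hcard⟩ := Infinite.exists_subset_card_eq ι n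
  have hpartial : Tendsto (fun x => ∑ i ∈ s, (1 - gaussianMultiplier (v i) x)) atTop (𝓝 n) := by
    simpa [hcard] using tendsto_finsetSum s fun i _ =>
      (tendsto_gaussianMultiplier_atTop (hv i)).const_sub 1
  filter_upwards [hpartial.eventually_const_lt hn] with x hx
  exact hx.le.trans ((summable_one_sub_gaussianMultiplier hs x).sum_le_tsum _
    fun i _ => sub_nonneg.2 (gaussianMultiplier_le_one _ x))

theorem gaussianDefect_mul_mem_WienerW0 [Countable ι] {f h : ℝ → ℂ}
    (hf : IsFourierIntegralOf f h) (hi : Integrable h) (hv : ∀ i, v i ≠ 0)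
    (hs : Summable fun i =>
      ∫ y, ‖h y - ((fun u => (gaussianPDFReal 0 (v i) u : ℂ)) ⋆[lsmul ℂ ℂ] h) y‖) :
    (fun x => (gaussianDefect v x : ℂ) * f x) ∈ WienerW0 := by
  have hpdf (i : ι) := integrable_ofReal_gaussianPDFReal 0 (v i)
  have hconv (i : ι) := (hpdf i).integrable_convolution (lsmul ℂ ℂ) hi
  have hterm (i : ι) := hf.sub ((isFourierIntegralOf_gaussianPDFReal (hv i)).mul hf (hpdf i) hi)
    hi (hconv i)
  convert! tsum_mem_WienerW0 hterm (fun i => hi.sub (hconv i)) hs using 2 with x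
  simp only [gaussianDefect, Complex.ofReal_tsum, Complex.ofReal_sub, Complex.ofReal_one,
    ← tsum_mul_right, sub_mul, one_mul]

end gaussianDefect

theorem exists_summable_gaussian_convolution_error {E : Type*} [NormedAddCommGroup E]
    [NormedSpace ℝ E] [NormedSpace ℂ E] [CompleteSpace E] {h : ℝ → E} (hi : Integrable h) :
    ∃ v : ℕ → ℝ≥0, (∀ j, v j ≠ 0) ∧ Summable v ∧ Summable fun j =>
      ∫ y, ‖h y - ((fun u => (gaussianPDFReal 0 (v j) u : ℂ)) ⋆[lsmul ℂ ℂ] h) y‖ := by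
  have hex (j : ℕ) : ∃ v : ℝ≥0, v ≠ 0 ∧ v < (1 / 2) ^ j ∧
      ∫ y, ‖h y - ((fun u => (gaussianPDFReal 0 v u : ℂ)) ⋆[lsmul ℂ ℂ] h) y‖ < (1 / 2) ^ j := by
    have hne : ∀ᶠ v : ℝ≥0 in 𝓝[≠] 0, v ≠ 0 := self_mem_nhdsWithin
    have hsmall : ∀ᶠ v : ℝ≥0 in 𝓝[≠] 0, v < (1 / 2) ^ j :=
      (eventually_lt_nhds (by positivity)).filter_mono nhdsWithin_le_nhds
    have herror := (tendsto_integral_norm_sub_gaussian_convolution hi).eventually_lt_const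
      (by positivity : (0 : ℝ) < (1 / 2) ^ j)
    exact (hne.and (hsmall.and herror)).exists
  choose v hv hsmall herror using hex
  refine ⟨v, hv, NNReal.summable_of_le (fun j => (hsmall j).le) (NNReal.summable_geometric ?_),
    summable_geometric_two.of_nonneg_of_le (fun j => by positivity) fun j => (herror j).le⟩
  exact NNReal.half_lt_self one_ne_zero

theorem exists_even_strictMonoOn_mul_mem_WienerW0 {f : ℝ → ℂ} (hf : f ∈ WienerW0) :
    ∃ g : ℝ → ℝ, Function.Even g ∧ StrictMonoOn g (Ici 0) ∧ Tendsto g atTop atTop ∧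
      (fun x : ℝ => (g x : ℂ) * f x) ∈ WienerW0 := by
  obtain ⟨h, hi, hF⟩ := hf
  obtain ⟨v, hv, hs, herror⟩ := exists_summable_gaussian_convolution_error hi
  exact ⟨gaussianDefect v, even_gaussianDefect v, strictMonoOn_gaussianDefect hv hs,
    tendsto_gaussianDefect_atTop hv hs, gaussianDefect_mul_mem_WienerW0 hF hi hv herror⟩

/-- The Gaussian mixture `∑ᵢ cᵢ exp (-vᵢ x² / 2)`, meant for summable weights `c`. -/
noncomputable def gaussianMixture {ι : Type*} (c : ι → ℝ) (v : ι → ℝ≥0) (x : ℝ) : ℝ :=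
  ∑' i, c i * gaussianMultiplier (v i) x

section gaussianMixture

variable {ι : Type*} {c : ι → ℝ} {v : ι → ℝ≥0}

theorem even_gaussianMixture (c : ι → ℝ) (v : ι → ℝ≥0) :
    Function.Even (gaussianMixture c v) := fun x => by
  simp only [gaussianMixture, gaussianMultiplier_neg]

theorem mul_gaussianMultiplier_le_gaussianMixture (hc : Summable c) (hc0 : ∀ i, 0 ≤ c i) (i : ι)
    (x : ℝ) : c i * gaussianMultiplier (v i) x ≤ gaussianMixture c v x := by
  have hnonneg (j : ι) : 0 ≤ c j * gaussianMultiplier (v j) x :=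
    mul_nonneg (hc0 j) (gaussianMultiplier_nonneg _ x)
  have hs : Summable fun j => c j * gaussianMultiplier (v j) x :=
    hc.of_nonneg_of_le hnonneg fun j =>
      mul_le_of_le_one_right (hc0 j) (gaussianMultiplier_le_one _ x)
  exact hs.le_tsum i fun j _ => hnonneg j

theorem gaussianMixture_nonneg (hc0 : ∀ i, 0 ≤ c i) (x : ℝ) : 0 ≤ gaussianMixture c v x :=
  tsum_nonneg fun i => mul_nonneg (hc0 i) (gaussianMultiplier_nonneg _ x)

theorem gaussianMixture_mem_WienerW0Star [Countable ι] (hc : Summable c) (hv : ∀ i, v i ≠ 0) :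
    (fun x => (gaussianMixture c v x : ℂ)) ∈ WienerW0Star := by
  have hnorm (i : ι) (y : ℝ) :
      ‖(c i : ℂ) * (gaussianPDFReal 0 (v i) y : ℂ)‖ = |c i| * gaussianPDFReal 0 (v i) y := by
    rw [norm_mul, Complex.norm_real, Complex.norm_real, Real.norm_eq_abs,
      Real.norm_of_nonneg (gaussianPDFReal_nonneg 0 (v i) y)]
  have hmass (i : ι) : ∫ y, ‖(c i : ℂ) * (gaussianPDFReal 0 (v i) y : ℂ)‖ = |c i| := by
    simp only [hnorm, integral_const_mul, integral_gaussianPDFReal_eq_one 0 (hv i), mul_one]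
  simp only [gaussianMixture, Complex.ofReal_tsum, Complex.ofReal_mul]
  refine tsum_mem_WienerW0Star
    (fun i => (isFourierIntegralOf_gaussianPDFReal (hv i)).const_mul (c i))
    (fun i => (integrable_ofReal_gaussianPDFReal 0 (v i)).const_mul _) ?_ fun i t s hts => ?_
  · simpa only [hmass] using hc.abs
  · simpa only [hnorm] using
      mul_le_mul_of_nonneg_left (gaussianPDFReal_zero_le_of_abs_le (v i) hts) (abs_nonneg (c i))

end gaussianMixture

theorem exists_summable_dominating {E : Type*} [SeminormedAddGroup E] {ε : E → ℝ}
    (hbdd : BddAbove (range ε)) (hlim : Tendsto ε (Bornology.cobounded E) (𝓝 0)) :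
    ∃ (a : ℕ → ℝ) (R : ℕ → ℝ≥0), Summable a ∧ (∀ j, 0 ≤ a j) ∧ (∀ j, R j ≠ 0) ∧
      ∀ x, 0 < ε x → ∃ j, ‖x‖ ≤ R j ∧ ε x ≤ a j := by
  obtain ⟨A, hA, hεA⟩ : ∃ A > 0, ∀ x, ε x ≤ A := by
    obtain ⟨B, hB⟩ := hbdd
    exact ⟨max B 1, by positivity, fun x => (hB (mem_range_self x)).trans (le_max_left B 1)⟩
  have hradius (j : ℕ) : ∃ R : ℝ≥0, R ≠ 0 ∧ ∀ x, A * (1 / 2) ^ (j + 1) < ε x → ‖x‖ ≤ R := by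
    obtain ⟨r, -, hr⟩ := (hasBasis_cobounded_norm (E := E)).eventually_iff.1
      (hlim.eventually_le_const (by positivity : 0 < A * (1 / 2) ^ (j + 1)))
    refine ⟨max r.toNNReal 1, by positivity, fun x hx => ?_⟩
    have hxr : ‖x‖ < r := lt_of_not_ge fun hrx => hx.not_ge (hr hrx)
    exact hxr.le.trans ((Real.le_coe_toNNReal r).trans (by exact_mod_cast le_max_left _ _))
  choose R hR0 hR using hradius
  refine ⟨fun j => A * (1 / 2) ^ j, R, summable_geometric_two.mul_left A,
    fun j => by positivity, hR0, fun x hx => ?_⟩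
  obtain ⟨j, hlt, hle⟩ := exists_nat_pow_near_of_lt_one (div_pos hx hA)
    ((div_le_one hA).2 (hεA x)) one_half_pos one_half_lt_one
  exact ⟨j, hR j x ((lt_div_iff₀' hA).1 hlt), (div_le_iff₀' hA).1 hle⟩

theorem exists_even_mem_WienerW0Star_ge {ε : ℝ → ℝ} (hbdd : BddAbove (range ε))
    (hlim : Tendsto ε (Bornology.cobounded ℝ) (𝓝 0)) :
    ∃ f : ℝ → ℝ, Function.Even f ∧ (fun x : ℝ => (f x : ℂ)) ∈ WienerW0Star ∧
      ∀ x, ε x ≤ f x := by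
  obtain ⟨a, R, ha, ha0, hR, hdom⟩ := exists_summable_dominating hbdd hlim
  let c (j : ℕ) : ℝ := Real.exp 1 * a j
  let v (j : ℕ) : ℝ≥0 := 2 / R j ^ 2
  have hc0 (j : ℕ) : 0 ≤ c j := mul_nonneg (Real.exp_pos 1).le (ha0 j)
  have hc : Summable c := ha.mul_left _
  have hv (j : ℕ) : v j ≠ 0 := div_ne_zero two_ne_zero (pow_ne_zero 2 (hR j))
  refine ⟨gaussianMixture c v, even_gaussianMixture c v, gaussianMixture_mem_WienerW0Star hc hv,
    fun x => ?_⟩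
  rcases le_or_gt (ε x) 0 with hx | hx
  · exact hx.trans (gaussianMixture_nonneg hc0 x)
  obtain ⟨j, hxR, hxa⟩ := hdom x hx
  calc ε x ≤ a j := hxa
    _ = c j * Real.exp (-1) := by
        rw [mul_right_comm, ← Real.exp_add, add_neg_cancel, Real.exp_zero, one_mul]
    _ ≤ c j * gaussianMultiplier (v j) x :=
        mul_le_mul_of_nonneg_left (exp_neg_one_le_gaussianMultiplier (hR j) hxR) (hc0 j)
    _ ≤ gaussianMixture c v x := mul_gaussianMultiplier_le_gaussianMixture hc hc0 j x

theorem mainTheorem7_general :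
    (∀ f ∈ WienerW0, ∃ g : ℝ → ℝ,
      Function.Even g ∧ StrictMonoOn g (Ici 0) ∧ Tendsto g atTop atTop ∧
      (fun x : ℝ => (g x : ℂ) * f x) ∈ WienerW0) ∧
    (∀ ε : ℝ → ℝ, BddAbove (range ε) → Tendsto ε (Bornology.cobounded ℝ) (𝓝 0) →
      ∃ f : ℝ → ℝ, Function.Even f ∧ (fun x : ℝ => (f x : ℂ)) ∈ WienerW0Star ∧
        ∀ x, ε x ≤ f x) :=
  ⟨fun _ hf => exists_even_strictMonoOn_mul_mem_WienerW0 hf,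
    fun _ hbdd hlim => exists_even_mem_WienerW0Star_ge hbdd hlim⟩

theorem mainTheorem7 :
    (∀ f ∈ WienerW0, ∃ g : ℝ → ℝ,
      Function.Even g ∧ StrictMonoOn g (Ici 0) ∧ Tendsto g atTop atTop ∧
      (fun x : ℝ => (g x : ℂ) * f x) ∈ WienerW0) ∧
    (∀ ε : ℕ → ℝ, Antitone ε → Tendsto ε atTop (𝓝 0) →
      ∃ f : ℝ → ℝ, Function.Even f ∧ (fun x : ℝ => (f x : ℂ)) ∈ WienerW0Star ∧
        ∀ k : ℕ, ε k ≤ f k) := by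
  refine ⟨mainTheorem7_general.1, fun ε _ hlim => ?_⟩
  obtain ⟨f, heven, hmem, hge⟩ := mainTheorem7_general.2 (fun x => ε ⌊‖x‖⌋₊)
    (hlim.bddAbove_range.mono (range_comp_subset_range _ ε))
    (hlim.comp (tendsto_nat_floor_atTop.comp tendsto_norm_cobounded_atTop))
  exact ⟨f, heven, hmem, fun k => by simpa using hge k⟩
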